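/- Conventions. For a complex $N\times N$ matrix $M$ let $\|M\|_2=\sqrt{\mathrm{Tr}(M^*M)}$ (unnormalized trace) be the Frobenius norm and $\|M\|$ the operator norm. A Frobenius asymptotic representation of a countable group $\Gamma$ is a sequence of functions $\rho_i:\Gamma\to U(N_i)$ with $\|\rho_i(xy)-\rho_i(x)\rho_i(y)\|_2\to 0$ for all $x,y\in\Gamma$. It is perturbable to genuine representations in the Frobenius (resp. operator) norm if there are unitary representations $\pi_i:\Gamma\to U(N_i)$ with $\|\pi_i(x)-\rho_i(x)\|_2\to 0$ (resp. $\|\pi_i(x)-\rho_i(x)\|\to 0$) for all $x\in\Gamma$. The group $\Gamma$ is Frobenius stable if every Frobenius asymptotic representation of $\Gamma$ is perturbable in the Frobenius norm. Cohomology has coefficients in $\mathbb{Z}$ with trivial action. For $\alpha\in\mathrm{Hom}(\Gamma,\mathbb{Z})$, a class in $H^2(\Gamma)$ is skinny with respect to $\alpha$ if its restriction to $\ker\alpha$ is zero. A Mal'cev basis of $\Gamma$ is a tuple $(a_1,\dots,a_m)$ such that every $g\in\Gamma$ is uniquely of the form $g=a_1^{x_1}\cdots a_m^{x_m}$ with $x=(x_1,\dots,x_m)\in\mathbb{Z}^m$,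 and such that the subgroups $\langle a_i,\dots,a_m\rangle$ form a central series of $\Gamma$; we then identify $g$ with $x$. If $m\ge 1$, the canonical homomorphism of the basis is $\alpha(x)=x_1$. Theorem. Let $\Gamma$ be a finitely generated torsion-free nilpotent group. (1) If some non-torsion class in $H^2(\Gamma)$ is skinny with respect to some $\alpha\in\mathrm{Hom}(\Gamma,\mathbb{Z})$, then $\Gamma$ is not Frobenius stable. (2) Let $a_1,\dots,a_m$ ($m\ge 1$) be a Mal'cev basis of $\Gamma$, and let $c\in H^2(\Gamma)$ be a non-torsion class that is skinny with respect to the canonical homomorphism. Then $c$ has a normalized cocycle representative $\sigma$ of the form $\sigma(x,y)=p(x_1,\dots,x_m,y_1)$ with $p\in\mathbb{Q}[x_1,\dots,x_m,y_1]$. Moreover, let $\sigma$ be any cocycle representative of $c$ of this form, with polynomial $p$. Then for every integer $n\ge 1$ coprime to the denominators of the coefficients of $p$ the formula $$\rho_n(x)\,\delta_{\bar j}=\exp\Bigl(\tfrac{2\pi i}{n}\,p(x_1,\dots,x_m,j)\Bigr)\,\delta_{\bar j+\bar x_1}\qquad(x\in\Gamma,\ j\in\mathbb{Z})$$ gives a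 well-defined map $\rho_n:\Gamma\to U(\ell^2(\mathbb{Z}/n\mathbb{Z}))$, where $\bar{\ }$ is reduction modulo $n$ and $(\delta_{\bar j})$ is the standard basis. Along every strictly increasing sequence of such $n$, the maps $\rho_n$ form a Frobenius asymptotic representation that is not perturbable to genuine representations in the Frobenius norm, nor even in the operator norm. -/

import Mathlib

open Filter Topology

noncomputable section

namespace SkinnyClass

/-! ### Norms and Frobenius stability -/

/-- The Frobenius norm `‖M‖₂ = √Tr(M* M)`, with the unnormalized trace. -/
def frobNorm {ι : Type*} [Fintype ι] (M : Matrix ι ι ℂ) : ℝ :=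
  Real.sqrt (Matrix.trace (M.conjTranspose * M)).re

/-- The operator norm of a square matrix acting on the Hilbert space `ℓ²(ι)`. -/
def opNorm {ι : Type*} [Fintype ι] [DecidableEq ι] (M : Matrix ι ι ℂ) : ℝ :=
  ‖Matrix.toEuclideanCLM (n := ι) (𝕜 := ℂ) M‖

section Stability

variable {Γ : Type*} [Group Γ] {ι : ℕ → Type*} [∀ i, Fintype (ι i)] [∀ i, DecidableEq (ι i)]

/-- A sequence of functions into finite-dimensional unitary groups is a Frobenius asymptotic
representation if it is asymptotically multiplicative in the Frobenius norm. -/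
def IsFrobeniusAsymptoticRep (ρ : ∀ i, Γ → Matrix.unitaryGroup (ι i) ℂ) : Prop :=
  ∀ x y : Γ, Tendsto
    (fun i => frobNorm ((ρ i (x * y)).1 - (ρ i x).1 * (ρ i y).1)) atTop (𝓝 0)

/-- The sequence is perturbable in the Frobenius norm to genuine unitary representations. -/
def IsFrobeniusPerturbable (ρ : ∀ i, Γ → Matrix.unitaryGroup (ι i) ℂ) : Prop :=
  ∃ π : ∀ i, Γ →* Matrix.unitaryGroup (ι i) ℂ, ∀ x : Γ, Tendsto
    (fun i => frobNorm ((π i x).1 - (ρ i x).1)) atTop (𝓝 0)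

/-- The sequence is perturbable in the operator norm to genuine unitary representations. -/
def IsOpNormPerturbable (ρ : ∀ i, Γ → Matrix.unitaryGroup (ι i) ℂ) : Prop :=
  ∃ π : ∀ i, Γ →* Matrix.unitaryGroup (ι i) ℂ, ∀ x : Γ, Tendsto
    (fun i => opNorm ((π i x).1 - (ρ i x).1)) atTop (𝓝 0)

end Stability

/-- `Γ` is Frobenius stable if every Frobenius asymptotic representation is perturbable in the
Frobenius norm to a sequence of genuine representations. -/
def FrobeniusStable (Γ : Type*) [Group Γ] : Prop :=
  ∀ (N : ℕ → ℕ) (ρ : ∀ i, Γ → Matrix.unitaryGroup (Fin (N i)) ℂ),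
    IsFrobeniusAsymptoticRep ρ → IsFrobeniusPerturbable ρ

/-! ### Mal'cev bases -/

section Malcev

variable {Γ : Type*} [Group Γ] {m : ℕ}

/-- The element `a₁ ^ x₁ ⋯ aₘ ^ xₘ`. -/
def canonicalForm (a : Fin m → Γ) (x : Fin m → ℤ) : Γ :=
  (List.ofFn fun i => a i ^ x i).prod

/-- A Mal'cev basis: every element has a unique canonical form, and the subgroups generated by the
tails of `a` form a central series (it reaches the trivial group at step `m`). -/
structure IsMalcevBasis (a : Fin m → Γ) : Prop where
  existsUnique_form : ∀ g : Γ, ∃! x : Fin m → ℤ, g = canonicalForm a x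
  central : Subgroup.IsDescendingCentralSeries fun i : ℕ =>
    Subgroup.closure {g : Γ | ∃ j : Fin m, i ≤ (j : ℕ) ∧ g = a j}

/-- `α` is the canonical homomorphism `a₁ ^ x₁ ⋯ aₘ ^ xₘ ↦ x₁` with respect to `a`. -/
def IsCanonicalHom (a : Fin (m + 1) → Γ) (α : Γ →* Multiplicative ℤ) : Prop :=
  ∀ x : Fin (m + 1) → ℤ, α (canonicalForm a x) = Multiplicative.ofAdd (x 0)

end Malcev

/-! ### Skinny cohomology classes -/

/-- `ℤ` with the trivial action of `Γ`. -/
abbrev trivialInt (Γ : Type) [Group Γ] : Rep ℤ Γ := Rep.trivial ℤ Γ ℤ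

/-- The identity of `ℤ`, from the restriction along `f` of the trivial module to the trivial module. -/
def resTrivialInt {Γ Λ : Type} [Group Γ] [Group Λ] (f : Γ →* Λ) :
    Rep.res f (trivialInt Λ) ⟶ trivialInt Γ :=
  Rep.ofHom ⟨LinearMap.id, fun _ => rfl⟩

/-- The map `f^* : H²(Λ; ℤ) → H²(Γ; ℤ)` induced by a group homomorphism `f : Γ → Λ`. -/
def H2pullback {Γ Λ : Type} [Group Γ] [Group Λ] (f : Γ →* Λ) :
    groupCohomology.H2 (trivialInt Λ) → groupCohomology.H2 (trivialInt Γ) :=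
  groupCohomology.map f (resTrivialInt f) 2

section Skinny

variable {Γ : Type} [Group Γ] {m : ℕ}

/-- `c` is skinny with respect to `α` if its restriction to `ker α` vanishes. -/
def IsSkinny (α : Γ →* Multiplicative ℤ) (c : groupCohomology.H2 (trivialInt Γ)) : Prop :=
  H2pullback α.ker.subtype c = 0

/-- The integer value `σ(g, h)` of a 2-cocycle. -/
def cocycleVal (σ : groupCohomology.cocycles₂ (trivialInt Γ)) (g h : Γ) : ℤ := σ (g, h)

/-- A 2-cocycle is normalized if it vanishes as soon as one of its arguments is trivial. -/
def IsNormalized (σ : groupCohomology.cocycles₂ (trivialInt Γ)) : Prop :=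
  ∀ g : Γ, cocycleVal σ g 1 = 0 ∧ cocycleVal σ 1 g = 0

/-- The value `p(x₁, …, xₘ, j)` at integers of a polynomial in `x₁, …, xₘ` (indexed by `some`) and
one further variable `y₁` (indexed by `none`). -/
def polyVal (p : MvPolynomial (Option (Fin (m + 1))) ℚ) (x : Fin (m + 1) → ℤ) (j : ℤ) : ℚ :=
  MvPolynomial.eval (fun o : Option (Fin (m + 1)) => o.elim (j : ℚ) fun i => (x i : ℚ)) p

/-- `σ` is given by the polynomial `p` in Mal'cev coordinates: `σ(x, y) = p(x₁, …, xₘ, y₁)`. -/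
def IsGivenBy (a : Fin (m + 1) → Γ) (σ : groupCohomology.cocycles₂ (trivialInt Γ))
    (p : MvPolynomial (Option (Fin (m + 1))) ℚ) : Prop :=
  ∀ x y : Fin (m + 1) → ℤ,
    (cocycleVal σ (canonicalForm a x) (canonicalForm a y) : ℚ) = polyVal p x (y 0)

/-- `n` is coprime to the denominators of all coefficients of `p`. -/
def CoprimeToDenominators (p : MvPolynomial (Option (Fin (m + 1))) ℚ) (n : ℕ) : Prop :=
  ∀ s, Nat.Coprime n (p.coeff s).den

/-- `ρ : Γ → U(ℓ²(ℤ/n))` satisfies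
`ρ(x) δ_j = exp((2πi/n) p(x₁, …, xₘ, j)) δ_{j + x₁}` for all `x ∈ Γ` and all integers `j`, where the
indices of the standard basis vectors are reduced modulo `n`. -/
def IsCocycleMap (a : Fin (m + 1) → Γ) (p : MvPolynomial (Option (Fin (m + 1))) ℚ)
    (n : ℕ) [NeZero n] (ρ : Γ → Matrix.unitaryGroup (ZMod n) ℂ) : Prop :=
  ∀ (x : Fin (m + 1) → ℤ) (j : ℤ),
    (ρ (canonicalForm a x) : Matrix (ZMod n) (ZMod n) ℂ).mulVec (Pi.single (j : ZMod n) 1) =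
      Complex.exp (2 * Real.pi * Complex.I / n * (polyVal p x j : ℂ)) •
        Pi.single ((j : ZMod n) + (x 0 : ZMod n)) (1 : ℂ)

end Skinny

end SkinnyClass

end

/-
If `c` restricts to zero on `ker α`, then `ker α` lifts to the central extension of `Γ` by `ℤ` with
class `c`. Choosing in addition a lift of an element `a` with `α a = 1` gives a section of the whole
extension; since `Γ` is nilpotent, conjugation by `a` acts unipotently on the lift, and so the
resulting cocycle `σ(g, h)` is a Newton polynomial in `α h`. It is therefore periodic in `α h`
modulo every `n` prime to its denominators, and the weighted shifts
`δ_{α h} ↦ exp(2πi σ(g, h) / n) δ_{α h + α g}` on `ℓ²(ℤ/n)` are well defined. They form a projective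
representation with multiplier `exp(2πi σ / n)`, so their Frobenius defect is `O(n^{-1/2})`.

If `π` is a genuine representation near a projective representation `ρ` of dimension `n` with this
multiplier, then `-i log det (π(g)⁻¹ ρ(g))` is a real cochain with coboundary `2πσ`, by additivity
of the phase `-i log det` near the identity. The solvability over `ℝ` of a linear system with
rational coefficients gives a rational primitive of `σ`; modulo `ℤ` it is a homomorphism to `ℚ/ℤ`,
which has finite image because `Γ` is finitely generated. Hence a multiple of `σ` is an integral
coboundary and `c` is torsion.
-/

namespace SkinnyClass

noncomputable section

section Phase

open scoped Matrix.Norms.L2Operator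
open Unitary selfAdjoint Matrix

instance isIsometricSMul_unitary {A : Type*} [NormedRing A] [StarRing A] [CStarRing A] :
    IsIsometricSMul (unitary A) (unitary A) where
  isometry_smul u := Isometry.of_dist_eq fun v w => by
    rw [Subtype.dist_eq, Subtype.dist_eq, dist_eq_norm, dist_eq_norm, smul_eq_mul, smul_eq_mul,
      Submonoid.coe_mul, Submonoid.coe_mul, ← mul_sub, CStarRing.norm_coe_unitary_mul]

instance isIsometricSMul_op_unitary {A : Type*} [NormedRing A] [StarRing A] [CStarRing A] :
    IsIsometricSMul (unitary A)ᵐᵒᵖ (unitary A) where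
  isometry_smul u := Isometry.of_dist_eq fun v w => by
    rw [Subtype.dist_eq, Subtype.dist_eq, dist_eq_norm, dist_eq_norm, MulOpposite.smul_eq_mul_unop,
      MulOpposite.smul_eq_mul_unop, Submonoid.coe_mul, Submonoid.coe_mul, ← sub_mul,
      CStarRing.norm_mul_coe_unitary]

variable {ι : Type*} [Fintype ι] [DecidableEq ι]

theorem det_exp_I_smul {A : Matrix ι ι ℂ} (hA : A.IsHermitian) :
    (NormedSpace.exp (Complex.I • A)).det = Complex.exp (A.trace * Complex.I) := by
  set U : Matrix ι ι ℂ := hA.eigenvectorUnitary.1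
  have star_mul_self : star U * U = 1 := Unitary.coe_star_mul_self hA.eigenvectorUnitary
  have hinv : U⁻¹ = star U := Matrix.inv_eq_left_inv star_mul_self
  have hunit : IsUnit U :=
    (Matrix.isUnit_iff_isUnit_det _).2 (Matrix.isUnit_det_of_left_inverse star_mul_self)
  have hspec : Complex.I • A =
      U * diagonal (Complex.I • fun j => (hA.eigenvalues j : ℂ)) * U⁻¹ := by
    rw [hinv, diagonal_smul, mul_smul_comm, smul_mul_assoc]
    exact congrArg (Complex.I • ·) (hA.spectral_theorem.trans (conjStarAlgAut_apply _ _))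
  rw [hspec, Matrix.exp_conj _ _ hunit, Matrix.det_conj hunit, Matrix.exp_diagonal, det_diagonal,
    hA.trace_eq_sum_eigenvalues, Finset.sum_mul, Complex.exp_sum]
  refine Finset.prod_congr rfl fun j _ => ?_
  rw [Pi.coe_exp, ← Complex.exp_eq_exp_ℂ, mul_comm]
  rfl

/-- The continuous branch of `-i log det` near `1` that vanishes at `1`, encoded as the trace of
the principal argument of `u`. -/
def phase (u : unitary (Matrix ι ι ℂ)) : ℝ :=
  (Matrix.trace (argSelfAdjoint u : Matrix ι ι ℂ)).re

theorem continuousOn_phase :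
    ContinuousOn (phase : unitary (Matrix ι ι ℂ) → ℝ) (Metric.ball 1 2) := by
  have continuous_re_trace :
      Continuous fun x : selfAdjoint (Matrix ι ι ℂ) => (Matrix.trace (x : Matrix ι ι ℂ)).re := by
    fun_prop
  exact continuous_re_trace.comp_continuousOn continuousOn_argSelfAdjoint

theorem phase_expUnitary {x : selfAdjoint (Matrix ι ι ℂ)} (hx : ‖x‖ < Real.pi) :
    phase (expUnitary x) = (Matrix.trace (x : Matrix ι ι ℂ)).re := by
  rw [phase, argSelfAdjoint_expUnitary hx]

theorem phase_one : phase (1 : unitary (Matrix ι ι ℂ)) = 0 := by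
  rw [← expUnitary_zero, phase_expUnitary (by simpa using Real.pi_pos)]
  simp

theorem coe_exp_phase {u : unitary (Matrix ι ι ℂ)} (hu : dist u 1 < 2) :
    (Circle.exp (phase u) : ℂ) = (u : Matrix ι ι ℂ).det := by
  have hA : (argSelfAdjoint u : Matrix ι ι ℂ).IsHermitian := (argSelfAdjoint u).2
  have coe_phase : ((phase u : ℝ) : ℂ) = (argSelfAdjoint u : Matrix ι ι ℂ).trace := by
    rw [phase, hA.trace_eq_sum_eigenvalues]
    simp
  rw [Subtype.dist_eq, dist_eq_norm] at hu
  rw [Circle.coe_exp, coe_phase, ← det_exp_I_smul hA]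
  conv_rhs => rw [← expUnitary_argSelfAdjoint hu, expUnitary_coe]

theorem dist_mul_one_lt_two {A : Type*} [NormedRing A] [StarRing A] [CStarRing A] {u v : unitary A}
    (hu : dist u 1 < 1) (hv : dist v 1 < 1) : dist (u * v) 1 < 2 :=
  calc dist (u * v) 1 ≤ dist (u * v) (u * 1) + dist (u * 1) 1 := dist_triangle _ _ _
    _ = dist v 1 + dist u 1 := by rw [dist_mul_left, mul_one]
    _ < 2 := by linarith

theorem dist_conj_one {A : Type*} [NormedRing A] [StarRing A] [CStarRing A] (g u : unitary A) :
    dist (g⁻¹ * u * g) 1 = dist u 1 :=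
  calc dist (g⁻¹ * u * g) 1 = dist (g⁻¹ * u * g) (g⁻¹ * 1 * g) := by
        rw [mul_one, inv_mul_cancel]
    _ = dist u 1 := by rw [dist_mul_right, dist_mul_left]

theorem phase_mul {u v : unitary (Matrix ι ι ℂ)} (hu : dist u 1 < 1) (hv : dist v 1 < 1) :
    phase (u * v) = phase u + phase v := by
  set B : Set (unitary (Matrix ι ι ℂ)) := Metric.ball 1 1
  have hB : IsPreconnected B :=
    (isPathConnected_ball 1 1 one_pos one_lt_two).isConnected.isPreconnected
  have hB_ball : B ⊆ Metric.ball 1 2 := Metric.ball_subset_ball one_le_two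
  have hmul : Set.MapsTo (fun p => p.1 * p.2) (B ×ˢ B) (Metric.ball 1 2) :=
    fun p hp => dist_mul_one_lt_two hp.1 hp.2
  have hcont_mul : ContinuousOn (fun p => phase (p.1 * p.2)) (B ×ˢ B) :=
    continuousOn_phase.comp continuous_mul.continuousOn hmul
  have hcont_add : ContinuousOn (fun p => phase p.1 + phase p.2) (B ×ˢ B) :=
    (continuousOn_phase.comp continuousOn_fst fun p hp => hB_ball hp.1).add
      (continuousOn_phase.comp continuousOn_snd fun p hp => hB_ball hp.2)
  -- Both sides lift `det (u * v)` along the covering `Circle.exp` and vanish at `(1, 1)`.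
  have heq : Set.EqOn (fun p => phase (p.1 * p.2)) (fun p => phase p.1 + phase p.2) (B ×ˢ B) := by
    refine Circle.isCoveringMap_exp.eqOn_of_comp_eqOn (hB.prod hB) hcont_mul hcont_add
      (fun p hp => Circle.ext ?_) (a := (1, 1)) (by simp [B]) (by simp [phase_one])
    rw [Function.comp_apply, Function.comp_apply, Circle.exp_add, Circle.coe_mul,
      coe_exp_phase (hmul hp), coe_exp_phase (hB_ball hp.1), coe_exp_phase (hB_ball hp.2),
      Submonoid.coe_mul, det_mul]
  exact heq (x := (u, v)) ⟨Metric.mem_ball.2 hu, Metric.mem_ball.2 hv⟩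

theorem phase_conj (g u : unitary (Matrix ι ι ℂ)) : phase (g⁻¹ * u * g) = phase u := by
  set φ := conjStarAlgAut ℂ (Matrix ι ι ℂ) g⁻¹
  have hconj : ((g⁻¹ * u * g : unitary _) : Matrix ι ι ℂ) = φ u := by
    rw [conjStarAlgAut_apply, ← Unitary.coe_star, ← Submonoid.coe_mul, ← Submonoid.coe_mul,
      Unitary.star_eq_inv, inv_inv]
  have hfin : (spectrum ℂ (u : Matrix ι ι ℂ)).Finite := Matrix.finite_spectrum _
  have harg : (argSelfAdjoint (g⁻¹ * u * g) : Matrix ι ι ℂ) = φ (argSelfAdjoint u) := by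
    rw [argSelfAdjoint_coe, argSelfAdjoint_coe, hconj]
    have : IsStarNormal (u : Matrix ι ι ℂ) := inferInstance
    have hcont : Continuous φ := φ.toAlgEquiv.toLinearMap.continuous_of_finiteDimensional
    refine (StarAlgHomClass.map_cfc φ (fun x => (Complex.arg x : ℂ)) (u : Matrix ι ι ℂ)
      (hfin.continuousOn _) hcont ?_ ?_).symm
    · infer_instance
    · rw [← hconj]; infer_instance
  rw [phase, harg, conjStarAlgAut_apply, Matrix.trace_mul_cycle, Unitary.coe_star_mul_self, one_mul,
    phase]

theorem norm_circleExp_sub_one_le (s : ℝ) : ‖(Circle.exp s : ℂ) - 1‖ ≤ |s| := by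
  rw [Circle.coe_exp, mul_comm]
  exact Real.norm_exp_I_mul_ofReal_sub_one_le

theorem norm_one_le_of_cstarRing (A : Type*) [NormedRing A] [StarRing A] [CStarRing A] :
    ‖(1 : A)‖ ≤ 1 := by
  nontriviality A
  exact CStarRing.norm_one.le

theorem coe_expUnitary_smul_one {A : Type*} [CStarAlgebra A] (s : ℝ) :
    (expUnitary (s • (1 : selfAdjoint A)) : A) = (Circle.exp s : ℂ) • (1 : A) := by
  have hsmul : Complex.I • ((s • (1 : selfAdjoint A) : selfAdjoint A) : A) =
      algebraMap ℂ A (s * Complex.I) := by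
    rw [selfAdjoint.val_smul, selfAdjoint.val_one, Algebra.algebraMap_eq_smul_one, mul_comm,
      mul_smul, Complex.coe_smul]
  rw [expUnitary_coe, hsmul, ← NormedSpace.algebraMap_exp_comm, ← Complex.exp_eq_exp_ℂ,
    Circle.coe_exp, Algebra.algebraMap_eq_smul_one]

theorem phase_eq_of_coe_eq_exp_smul {u v : unitary (Matrix ι ι ℂ)} {s : ℝ}
    (huv : (u : Matrix ι ι ℂ) = (Circle.exp s : ℂ) • (v : Matrix ι ι ℂ)) (hs : |s| < 1)
    (hv : dist v 1 < 1) : phase u = Fintype.card ι * s + phase v := by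
  set x : selfAdjoint (Matrix ι ι ℂ) := s • 1
  have hu : u = expUnitary x * v := Subtype.ext <| by
    rw [huv, Submonoid.coe_mul, coe_expUnitary_smul_one, smul_mul_assoc, one_mul]
  have hone : ‖(1 : Matrix ι ι ℂ)‖ ≤ 1 := norm_one_le_of_cstarRing _
  have hdist : dist (expUnitary x) 1 < 1 := by
    rw [Subtype.dist_eq, dist_eq_norm, coe_expUnitary_smul_one, OneMemClass.coe_one]
    nth_rw 2 [← one_smul ℂ (1 : Matrix ι ι ℂ)]
    rw [← sub_smul, norm_smul]
    exact (mul_le_of_le_one_right (norm_nonneg _) hone).trans_lt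
      ((norm_circleExp_sub_one_le s).trans_lt hs)
  have hx : ‖x‖ < Real.pi := by
    rw [norm_smul]
    exact (mul_le_of_le_one_right (norm_nonneg _) hone).trans_lt
      (hs.trans (by linarith [Real.pi_gt_three]))
  rw [hu, phase_mul hdist hv, phase_expUnitary hx]
  simp [x, Matrix.trace_smul, mul_comm]

end Phase

section Norms

variable {ι : Type*} [Fintype ι]

theorem frobNorm_eq_sqrt_sum (M : Matrix ι ι ℂ) :
    frobNorm M = Real.sqrt (∑ i, ∑ j, ‖M i j‖ ^ 2) := by
  rw [frobNorm, Matrix.trace]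
  congr 1
  rw [Finset.sum_comm]
  simp only [Matrix.diag, Matrix.mul_apply, Matrix.conjTranspose_apply, Complex.re_sum]
  refine Finset.sum_congr rfl fun i _ => Finset.sum_congr rfl fun j _ => ?_
  rw [Complex.star_def, ← Complex.normSq_eq_conj_mul_self, Complex.ofReal_re,
    Complex.normSq_eq_norm_sq]

theorem opNorm_le_frobNorm [DecidableEq ι] (M : Matrix ι ι ℂ) : opNorm M ≤ frobNorm M := by
  rw [opNorm, frobNorm_eq_sqrt_sum]
  refine ContinuousLinearMap.opNorm_le_bound _ (Real.sqrt_nonneg _) fun v => ?_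
  rw [EuclideanSpace.norm_eq, EuclideanSpace.norm_eq, ← Real.sqrt_mul (by positivity),
    Finset.sum_mul]
  refine Real.sqrt_le_sqrt (Finset.sum_le_sum fun i _ => ?_)
  have hrow : ‖(Matrix.toEuclideanCLM (n := ι) (𝕜 := ℂ) M v) i‖ ≤ ∑ j, ‖M i j‖ * ‖v j‖ := by
    rw [Matrix.ofLp_toEuclideanCLM, Matrix.mulVec, dotProduct]
    exact (norm_sum_le _ _).trans_eq (Finset.sum_congr rfl fun j _ => norm_mul _ _)
  exact (pow_le_pow_left₀ (norm_nonneg _) hrow 2).trans (Finset.sum_mul_sq_le_sq_mul_sq _ _ _)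

theorem frobNorm_smul_unitary [DecidableEq ι] (c : ℂ) (u : Matrix.unitaryGroup ι ℂ) :
    frobNorm (c • u.1) = ‖c‖ * Real.sqrt (Fintype.card ι) := by
  have hu : u.1.conjTranspose * u.1 = 1 := Unitary.coe_star_mul_self u
  rw [frobNorm, Matrix.conjTranspose_smul, smul_mul_smul_comm, hu, Matrix.trace_smul,
    Matrix.trace_one, Complex.star_def, ← Complex.normSq_eq_conj_mul_self,
    Complex.normSq_eq_norm_sq, smul_eq_mul, Complex.re_ofReal_mul, Complex.natCast_re,
    Real.sqrt_mul (by positivity), Real.sqrt_sq (norm_nonneg c)]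

theorem IsFrobeniusPerturbable.isOpNormPerturbable {Γ : Type*} [Group Γ] {κ : ℕ → Type*}
    [∀ i, Fintype (κ i)] [∀ i, DecidableEq (κ i)] {ρ : ∀ i, Γ → Matrix.unitaryGroup (κ i) ℂ}
    (hρ : IsFrobeniusPerturbable ρ) : IsOpNormPerturbable ρ :=
  hρ.imp fun _ hπ x =>
    squeeze_zero (fun _ => norm_nonneg _) (fun _ => opNorm_le_frobNorm _) (hπ x)

end Norms

section Coboundary

variable {Γ : Type*} [Mul Γ] {A B : Type*} [AddCommGroup A] [AddCommGroup B]

/-- The inhomogeneous coboundary of a 1-cochain with trivial coefficients. -/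
def coboundary (b : Γ → A) (x y : Γ) : A :=
  b x + b y - b (x * y)

theorem map_coboundary (f : A →+ B) (b : Γ → A) (x y : Γ) :
    f (coboundary b x y) = coboundary (fun g => f (b g)) x y := by
  simp only [coboundary, map_add, map_sub]

theorem exists_linearMap_forall_eq {K L V ι : Type*} [Field K] [CommRing L] [Nontrivial L]
    [Algebra K L] [AddCommGroup V] [Module K V] {v : ι → V} {c : ι → K}
    (h : ∀ s : Finset ι, ∃ f : V →ₗ[K] L, ∀ i ∈ s, f (v i) = algebraMap K L (c i)) :
    ∃ f : V →ₗ[K] K, ∀ i, f (v i) = c i := by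
  set F := Finsupp.linearCombination K v
  set S := Finsupp.linearCombination K c
  have hS : S ∈ (LinearMap.ker F).dualAnnihilator := by
    refine (Submodule.mem_dualAnnihilator _).2 fun l hl => ?_
    obtain ⟨f, hf⟩ := h l.support
    have hfS : f (F l) = algebraMap K L (S l) := by
      rw [Finsupp.apply_linearCombination, ← Algebra.linearMap_apply,
        Finsupp.apply_linearCombination]
      exact Finsupp.sum_congr fun i hi => congrArg _ (hf i hi)
    rw [LinearMap.mem_ker.1 hl, map_zero] at hfS
    exact (map_eq_zero_iff _ (algebraMap K L).injective).1 hfS.symm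
  rw [← LinearMap.range_dualMap_eq_dualAnnihilator_ker] at hS
  obtain ⟨f, hf⟩ := hS
  refine ⟨f, fun i => ?_⟩
  simpa [F, S] using LinearMap.congr_fun hf (Finsupp.single i 1)

/-- Each finite subsystem of the equations `coboundary t x y = σ x y` is solved over `ℝ` by some
`τ i`, so by linear algebra the whole system is solvable over `ℚ`. -/
theorem exists_rat_coboundary_eq {σ : Γ → Γ → ℚ} {β : Type*} {l : Filter β} [l.NeBot]
    {τ : β → Γ → ℝ} (hτ : ∀ x y, ∀ᶠ i in l, coboundary (τ i) x y = σ x y) :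
    ∃ t : Γ → ℚ, ∀ x y, coboundary t x y = σ x y := by
  set δ : Γ → Γ →₀ ℚ := fun g => Finsupp.single g 1
  obtain ⟨f, hf⟩ := exists_linearMap_forall_eq (L := ℝ)
    (v := fun z : Γ × Γ => coboundary δ z.1 z.2) (c := fun z => σ z.1 z.2) fun s => by
      obtain ⟨i, hi⟩ :=
        ((Filter.eventually_all_finset s).2 fun (z : Γ × Γ) _ => hτ z.1 z.2).exists
      refine ⟨Finsupp.linearCombination ℚ (τ i), fun z hz => ?_⟩
      have := map_coboundary (Finsupp.linearCombination ℚ (τ i)).toAddMonoidHom δ z.1 z.2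
      simpa [δ, hi z hz] using this
  exact ⟨fun x => f (δ x), fun x y =>
    (map_coboundary f.toAddMonoidHom δ x y).symm.trans (hf (x, y))⟩

end Coboundary

section BoundedDenominators

theorem exists_pow_eq_one_of_isMulTorsion {G A : Type*} [Group G] [Group.FG G] [CommGroup A]
    (hA : IsMulTorsion A) (f : G →* A) : ∃ n : ℕ, 0 < n ∧ ∀ g, f g ^ n = 1 := by
  have : Finite f.range := CommGroup.finite_of_fg_isMulTorsion _ (hA.subgroup _)
  exact ⟨Nat.card f.range, Nat.card_pos, fun g =>
    congrArg Subtype.val (pow_card_eq_one' (x := (⟨f g, g, rfl⟩ : f.range)))⟩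

theorem isAddTorsion_addCircle_rat : IsAddTorsion (AddCircle (1 : ℚ)) := by
  intro q
  induction q using QuotientAddGroup.induction_on with
  | H q =>
    refine isOfFinAddOrder_iff_nsmul_eq_zero.2 ⟨q.den, q.den_pos, ?_⟩
    rw [← AddCircle.coe_nsmul, AddCircle.coe_eq_zero_iff]
    exact ⟨q.num, by rw [zsmul_one, nsmul_eq_mul, Rat.den_mul_eq_num]⟩

theorem exists_int_coboundary_eq_mul {Γ : Type*} [Group Γ] [Group.FG Γ] {σ : Γ → Γ → ℤ}
    {t : Γ → ℚ} (ht : ∀ x y, coboundary t x y = σ x y) :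
    ∃ D : ℕ, 0 < D ∧ ∃ b : Γ → ℤ, ∀ x y, coboundary b x y = D * σ x y := by
  let φ : Γ →* Multiplicative (AddCircle (1 : ℚ)) :=
    MonoidHom.mk' (fun g => Multiplicative.ofAdd (t g : AddCircle (1 : ℚ))) fun x y => by
      rw [← ofAdd_add, ← AddCircle.coe_add, Equiv.apply_eq_iff_eq, eq_comm, ← sub_eq_zero,
        ← AddCircle.coe_sub, AddCircle.coe_eq_zero_iff]
      exact ⟨σ x y, by rw [zsmul_one, ← ht, coboundary]⟩
  have htorsion : IsMulTorsion (Multiplicative (AddCircle (1 : ℚ))) := fun q =>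
    (isOfFinOrder_ofAdd_iff (x := q.toAdd)).2 (isAddTorsion_addCircle_rat _)
  obtain ⟨D, hD, hφ⟩ := exists_pow_eq_one_of_isMulTorsion htorsion φ
  have hint : ∀ g, ∃ k : ℤ, (k : ℚ) = D * t g := fun g => by
    have hg : ((D • t g : ℚ) : AddCircle (1 : ℚ)) = 0 := congrArg Multiplicative.toAdd (hφ g)
    simpa using (AddCircle.coe_eq_zero_iff (1 : ℚ)).1 hg
  choose b hb using hint
  refine ⟨D, hD, b, fun x y => Int.cast_injective (α := ℚ) ?_⟩
  push_cast
  rw [coboundary, Int.cast_sub, Int.cast_add, hb, hb, hb, ← ht, coboundary]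
  ring

end BoundedDenominators

section ProjectiveRep

variable {Γ : Type*} [Group Γ]

/-- `ρ` is a projective representation with multiplier `exp (i θ)`. -/
def IsProjectiveRep {ι : Type*} [Fintype ι] [DecidableEq ι] (θ : Γ → Γ → ℝ)
    (ρ : Γ → Matrix.unitaryGroup ι ℂ) : Prop :=
  ∀ x y, (ρ x).1 * (ρ y).1 = (Circle.exp (θ x y) : ℂ) • (ρ (x * y)).1

/-- The multiplier `exp (2πi σ / N)`, to be used in dimension `N`, as an angle. -/
def cocycleAngle (N : ℕ) (σ : Γ → Γ → ℤ) (x y : Γ) : ℝ :=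
  2 * Real.pi * σ x y / N

section

variable {ι : Type*} [Fintype ι] [DecidableEq ι] {θ : Γ → Γ → ℝ} {ρ : Γ → Matrix.unitaryGroup ι ℂ}

theorem IsProjectiveRep.frobNorm_sub_le (hρ : IsProjectiveRep θ ρ) (x y : Γ) :
    frobNorm ((ρ (x * y)).1 - (ρ x).1 * (ρ y).1) ≤ |θ x y| * Real.sqrt (Fintype.card ι) := by
  have hdefect : (ρ (x * y)).1 - (ρ x).1 * (ρ y).1 =
      (1 - (Circle.exp (θ x y) : ℂ)) • (ρ (x * y)).1 := by
    rw [hρ, sub_smul, one_smul]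
  rw [hdefect, frobNorm_smul_unitary, norm_sub_rev]
  exact mul_le_mul_of_nonneg_right (norm_circleExp_sub_one_le _) (Real.sqrt_nonneg _)

open scoped Matrix.Norms.L2Operator in
theorem dist_inv_mul_one_eq_opNorm (u v : Matrix.unitaryGroup ι ℂ) :
    dist (u⁻¹ * v) 1 = opNorm (u.1 - v.1) := by
  rw [← inv_mul_cancel u, dist_mul_left, dist_comm, Subtype.dist_eq, dist_eq_norm]
  rfl

open scoped Matrix.Norms.L2Operator in
theorem IsProjectiveRep.coboundary_phase (hρ : IsProjectiveRep θ ρ)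
    (π : Γ →* Matrix.unitaryGroup ι ℂ) {x y : Γ} (hθ : |θ x y| < 1)
    (hx : opNorm ((π x).1 - (ρ x).1) < 1) (hy : opNorm ((π y).1 - (ρ y).1) < 1)
    (hxy : opNorm ((π (x * y)).1 - (ρ (x * y)).1) < 1) :
    coboundary (fun g => phase ((π g)⁻¹ * ρ g)) x y = Fintype.card ι * θ x y := by
  set d : Γ → Matrix.unitaryGroup ι ℂ := fun g => (π g)⁻¹ * ρ g
  rw [← dist_inv_mul_one_eq_opNorm] at hx hy hxy
  have hmul : ((π y)⁻¹ * d x * π y) * d y = (π (x * y))⁻¹ * (ρ x * ρ y) := by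
    simp only [d, map_mul]
    group
  have hcoe : (((π y)⁻¹ * d x * π y * d y : Matrix.unitaryGroup ι ℂ) : Matrix ι ι ℂ) =
      (Circle.exp (θ x y) : ℂ) • (d (x * y) : Matrix ι ι ℂ) := by
    rw [hmul, Submonoid.coe_mul, Submonoid.coe_mul, hρ, mul_smul_comm, Submonoid.coe_mul]
  have hconj : dist ((π y)⁻¹ * d x * π y) 1 < 1 := (dist_conj_one (π y) (d x)).trans_lt hx
  have hsum : phase (d x) + phase (d y) = Fintype.card ι * θ x y + phase (d (x * y)) := by
    rw [← phase_conj (π y) (d x), ← phase_mul hconj hy, phase_eq_of_coe_eq_exp_smul hcoe hθ hxy]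
  rw [coboundary, hsum, add_sub_cancel_right]

end

section Sequence

variable {κ : ℕ → Type*} [∀ i, Fintype (κ i)] [∀ i, DecidableEq (κ i)] {σ : Γ → Γ → ℤ}
  {ρ : ∀ i, Γ → Matrix.unitaryGroup (κ i) ℂ}

theorem isFrobeniusAsymptoticRep_of_isProjectiveRep
    (hcard : Tendsto (fun i => Fintype.card (κ i)) atTop atTop)
    (hρ : ∀ i, IsProjectiveRep (cocycleAngle (Fintype.card (κ i)) σ) (ρ i)) :
    IsFrobeniusAsymptoticRep ρ := by
  intro x y
  have hlim : Tendsto (fun i => |2 * Real.pi * σ x y| / Real.sqrt (Fintype.card (κ i)))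
      atTop (𝓝 0) :=
    (Real.tendsto_sqrt_atTop.comp (tendsto_natCast_atTop_atTop.comp hcard)).const_div_atTop _
  refine squeeze_zero (fun i => Real.sqrt_nonneg _)
    (fun i => ((hρ i).frobNorm_sub_le x y).trans_eq ?_) hlim
  rw [cocycleAngle, abs_div, Nat.abs_cast, div_mul_eq_mul_div, mul_div_assoc, Real.sqrt_div_self,
    ← div_eq_mul_inv]

theorem exists_int_coboundary_eq_mul_of_isOpNormPerturbable [Group.FG Γ]
    (hcard : Tendsto (fun i => Fintype.card (κ i)) atTop atTop)
    (hρ : ∀ i, IsProjectiveRep (cocycleAngle (Fintype.card (κ i)) σ) (ρ i))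
    (hpert : IsOpNormPerturbable ρ) :
    ∃ D : ℕ, 0 < D ∧ ∃ b : Γ → ℤ, ∀ x y, coboundary b x y = D * σ x y := by
  obtain ⟨π, hπ⟩ := hpert
  have hclose : ∀ g : Γ, ∀ᶠ i in atTop, opNorm ((π i g).1 - (ρ i g).1) < 1 := fun g =>
    (hπ g).eventually_lt_const one_pos
  have hsmall : ∀ x y, ∀ᶠ i in atTop, |cocycleAngle (Fintype.card (κ i)) σ x y| < 1 := by
    intro x y
    have hlim := ((tendsto_natCast_atTop_atTop.comp hcard).const_div_atTop
      (2 * Real.pi * σ x y)).abs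
    rw [abs_zero] at hlim
    exact hlim.eventually_lt_const one_pos
  have hprimitive : ∀ x y, ∀ᶠ i in atTop,
      coboundary (fun g => phase ((π i g)⁻¹ * ρ i g) / (2 * Real.pi)) x y = (σ x y : ℚ) := by
    intro x y
    filter_upwards [hclose x, hclose y, hclose (x * y), hsmall x y, hcard.eventually_gt_atTop 0]
      with i hx hy hxy hθ hpos
    have hphase := (hρ i).coboundary_phase (π i) hθ hx hy hxy
    rw [cocycleAngle, mul_div_cancel₀ _ (by exact_mod_cast hpos.ne'), coboundary] at hphase
    rw [coboundary, ← add_div, ← sub_div, hphase, mul_div_cancel_left₀ _ Real.two_pi_pos.ne',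
      Rat.cast_intCast]
  obtain ⟨t, ht⟩ := exists_rat_coboundary_eq hprimitive
  exact exists_int_coboundary_eq_mul ht

end Sequence

end ProjectiveRep

section Shift

theorem star_mul_self_weightedShift {G : Type*} [AddRightCancelSemigroup G] [Fintype G]
    [DecidableEq G] (k : G) (w : G → Circle) :
    star (Matrix.of fun i j => if i = j + k then (w j : ℂ) else 0) *
      Matrix.of (fun i j => if i = j + k then (w j : ℂ) else 0) = 1 := by
  ext i j
  simp only [Matrix.mul_apply, Matrix.star_apply, Matrix.of_apply, apply_ite star, star_zero,
    ite_mul, zero_mul, Finset.sum_ite_eq', Finset.mem_univ, if_true, add_left_inj,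
    Matrix.one_apply]
  split_ifs with h
  · subst h
    rw [Complex.star_def, ← Circle.coe_inv_eq_conj, ← Circle.coe_mul, inv_mul_cancel,
      Circle.coe_one]
  · rw [mul_zero]

/-- The weighted shift `δ_j ↦ w_j δ_{j + k}` on `ℓ²(G)`. -/
def weightedShift {G : Type*} [AddRightCancelSemigroup G] [Fintype G] [DecidableEq G] (k : G)
    (w : G → Circle) : Matrix.unitaryGroup G ℂ :=
  ⟨_, Matrix.mem_unitaryGroup_iff'.2 (star_mul_self_weightedShift k w)⟩

theorem weightedShift_mulVec_single {G : Type*} [AddRightCancelSemigroup G] [Fintype G]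
    [DecidableEq G] (k : G) (w : G → Circle) (j : G) :
    (weightedShift k w).1.mulVec (Pi.single j 1) = (w j : ℂ) • Pi.single (j + k) (1 : ℂ) := by
  ext i
  by_cases h : i = j + k <;> simp [weightedShift, h]

theorem toCircle_intCast_eq_circleExp_cocycleAngle {Γ : Type*} {n : ℕ} [NeZero n]
    (σ : Γ → Γ → ℤ) (x y : Γ) :
    ZMod.toCircle (σ x y : ZMod n) = Circle.exp (cocycleAngle n σ x y) := by
  ext
  rw [ZMod.toCircle_intCast, Circle.coe_exp, cocycleAngle]
  push_cast
  ring_nf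

variable {Γ : Type*} [Group Γ]

/-- `σ(g, h)` modulo `n` depends on `h` only through `α h` modulo `n`. -/
def IsPeriodicMod (n : ℕ) (α : Γ →* Multiplicative ℤ) (σ : Γ → Γ → ℤ) : Prop :=
  ∀ g h h', ((α h).toAdd : ZMod n) = (α h').toAdd → (σ g h : ZMod n) = σ g h'

/-- The map `Γ → U(ℓ²(ℤ/n))` with `ρ(g) δ_{α h} = exp (2πi σ(g, h) / n) δ_{α h + α g}` attached to a
cochain `σ` that is periodic modulo `n`; the index `j` is represented as `α (a ^ j)`, where
`α a = 1`. -/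
def cocycleShift (n : ℕ) [NeZero n] (α : Γ →* Multiplicative ℤ) (a : Γ) (σ : Γ → Γ → ℤ) (g : Γ) :
    Matrix.unitaryGroup (ZMod n) ℂ :=
  weightedShift ((α g).toAdd : ZMod n) fun j => ZMod.toCircle (σ g (a ^ j.val) : ZMod n)

variable {n : ℕ} [NeZero n] {α : Γ →* Multiplicative ℤ} {a : Γ} {σ : Γ → Γ → ℤ}

theorem cocycleShift_mulVec_single (ha : α a = Multiplicative.ofAdd 1)
    (hσ : IsPeriodicMod n α σ) (g h : Γ) :
    (cocycleShift n α a σ g).1.mulVec (Pi.single ((α h).toAdd : ZMod n) 1) =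
      (ZMod.toCircle (σ g h : ZMod n) : ℂ) •
        Pi.single (((α h).toAdd : ZMod n) + (α g).toAdd) (1 : ℂ) := by
  have hα : ((α (a ^ ((α h).toAdd : ZMod n).val)).toAdd : ZMod n) = (α h).toAdd := by
    rw [map_pow, ha, toAdd_pow, toAdd_ofAdd, nsmul_one, Int.cast_natCast, ZMod.natCast_zmod_val]
  rw [cocycleShift, weightedShift_mulVec_single, hσ _ _ _ hα]

theorem matrix_eq_of_mulVec_single_toAdd (ha : α a = Multiplicative.ofAdd 1)
    {M N : Matrix (ZMod n) (ZMod n) ℂ}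
    (h : ∀ g, M.mulVec (Pi.single ((α g).toAdd : ZMod n) 1) =
      N.mulVec (Pi.single ((α g).toAdd : ZMod n) 1)) : M = N := by
  refine Matrix.ext_of_mulVec_single fun j => ?_
  obtain ⟨j, rfl⟩ := ZMod.intCast_surjective j
  simpa [ha] using h (a ^ j)

theorem isProjectiveRep_cocycleShift (ha : α a = Multiplicative.ofAdd 1)
    (hσ : IsPeriodicMod n α σ) (hcoc : ∀ x y z, σ (x * y) z + σ x y = σ y z + σ x (y * z)) :
    IsProjectiveRep (cocycleAngle n σ) (cocycleShift n α a σ) := by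
  refine fun x y => matrix_eq_of_mulVec_single_toAdd ha fun z => ?_
  have hαyz : ((α z).toAdd : ZMod n) + (α y).toAdd = ((α (y * z)).toAdd : ZMod n) := by
    rw [map_mul, toAdd_mul, Int.cast_add, add_comm]
  have hαxyz : ((α (y * z)).toAdd : ZMod n) + (α x).toAdd =
      (α z).toAdd + (α (x * y)).toAdd := by
    rw [← hαyz, map_mul, toAdd_mul, Int.cast_add, add_assoc, add_comm ((α y).toAdd : ZMod n)]
  have hmult : (ZMod.toCircle (σ y z : ZMod n) * ZMod.toCircle (σ x (y * z) : ZMod n) : ℂ) =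
      Circle.exp (cocycleAngle n σ x y) * ZMod.toCircle (σ (x * y) z : ZMod n) := by
    rw [← toCircle_intCast_eq_circleExp_cocycleAngle, ← Circle.coe_mul, ← Circle.coe_mul,
      ← AddChar.map_add_eq_mul, ← AddChar.map_add_eq_mul, ← Int.cast_add, ← Int.cast_add, ← hcoc,
      add_comm]
  rw [← Matrix.mulVec_mulVec, cocycleShift_mulVec_single ha hσ, Matrix.mulVec_smul, hαyz,
    cocycleShift_mulVec_single ha hσ, hαxyz, smul_smul, hmult, Matrix.smul_mulVec,
    cocycleShift_mulVec_single ha hσ, smul_smul]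

end Shift

section Cohomology

open groupCohomology

variable {Γ : Type} [Group Γ]

theorem cocycleVal_mul_left (σ : cocycles₂ (trivialInt Γ)) (x y z : Γ) :
    cocycleVal σ (x * y) z + cocycleVal σ x y = cocycleVal σ y z + cocycleVal σ x (y * z) :=
  (mem_cocycles₂_iff (A := trivialInt Γ) σ).1 σ.2 x y z

theorem exists_coboundary_cocycle (b : Γ → ℤ) :
    ∃ τ : cocycles₂ (trivialInt Γ), ∀ x y, cocycleVal τ x y = coboundary b x y := by
  refine ⟨⟨fun z => coboundary b z.1 z.2, (mem_cocycles₂_iff (A := trivialInt Γ) _).2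
    fun x y z => ?_⟩, fun x y => rfl⟩
  change coboundary b (x * y) z + coboundary b x y = coboundary b y z + coboundary b x (y * z)
  simp only [coboundary, mul_assoc]
  ring

theorem H2π_eq_zero_iff_exists_coboundary (σ : cocycles₂ (trivialInt Γ)) :
    H2π (trivialInt Γ) σ = 0 ↔ ∃ b : Γ → ℤ, ∀ x y, coboundary b x y = cocycleVal σ x y := by
  have d₁₂_apply : ∀ b : Γ → ℤ, d₁₂ (trivialInt Γ) b = fun z => coboundary b z.1 z.2 := by
    intro b
    ext z
    change b z.2 - b (z.1 * z.2) + b z.1 = coboundary b z.1 z.2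
    rw [coboundary]
    ring
  rw [H2π_eq_zero_iff]
  refine exists_congr fun b => ?_
  rw [d₁₂_apply]
  exact ⟨fun h x y => congrFun h (x, y), fun h => funext fun z => h z.1 z.2⟩

theorem isSkinny_H2π_iff (α : Γ →* Multiplicative ℤ) (σ : cocycles₂ (trivialInt Γ)) :
    IsSkinny α (H2π (trivialInt Γ) σ) ↔
      ∃ b : α.ker → ℤ, ∀ x y, coboundary b x y = cocycleVal σ x y := by
  have h : H2pullback α.ker.subtype (H2π (trivialInt Γ) σ) =
      H2π (trivialInt α.ker) (mapCocycles₂ α.ker.subtype (resTrivialInt α.ker.subtype) σ) :=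
    H2π_comp_map_apply α.ker.subtype (resTrivialInt α.ker.subtype) σ
  rw [IsSkinny, h, H2π_eq_zero_iff_exists_coboundary]
  rfl

theorem IsSkinny.of_ker_eq {α β : Γ →* Multiplicative ℤ} (h : β.ker = α.ker)
    {c : H2 (trivialInt Γ)} (hc : IsSkinny α c) : IsSkinny β c := by
  induction c using H2_induction_on with | h σ => ?_
  obtain ⟨b, hb⟩ := (isSkinny_H2π_iff α σ).1 hc
  exact (isSkinny_H2π_iff β σ).2 ⟨fun x => b (Subgroup.inclusion h.le x), fun x y =>
    hb (Subgroup.inclusion h.le x) (Subgroup.inclusion h.le y)⟩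

theorem IsSkinny.eq_zero {c : H2 (trivialInt Γ)} (hc : IsSkinny 1 c) : c = 0 := by
  induction c using H2_induction_on with | h σ => ?_
  obtain ⟨b, hb⟩ := (isSkinny_H2π_iff 1 σ).1 hc
  exact (H2π_eq_zero_iff_exists_coboundary σ).2
    ⟨fun x => b ⟨x, rfl⟩, fun x y => hb ⟨x, rfl⟩ ⟨y, rfl⟩⟩

theorem isOfFinAddOrder_H2π {σ : cocycles₂ (trivialInt Γ)} {D : ℕ} (hD : 0 < D) {b : Γ → ℤ}
    (hb : ∀ x y, coboundary b x y = D * cocycleVal σ x y) :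
    IsOfFinAddOrder (H2π (trivialInt Γ) σ) := by
  refine isOfFinAddOrder_iff_nsmul_eq_zero.2 ⟨D, hD, ?_⟩
  rw [← map_nsmul, H2π_eq_zero_iff_exists_coboundary]
  refine ⟨b, fun x y => ?_⟩
  rw [hb, ← nsmul_eq_mul]
  rfl

end Cohomology

section CentralExtension

open groupCohomology

variable {Γ : Type} [Group Γ]

/-- The central extension of `Γ` by `ℤ` defined by a cocycle, with underlying set `ℤ × Γ`. Since
the cocycle need not be normalized, the identity is `(-σ(1, 1), 1)`. -/
@[ext]
structure CocycleExt (σ : cocycles₂ (trivialInt Γ)) where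
  fst : ℤ
  snd : Γ

namespace CocycleExt

variable {σ : cocycles₂ (trivialInt Γ)}

instance : Mul (CocycleExt σ) :=
  ⟨fun e f => ⟨e.fst + f.fst + cocycleVal σ e.snd f.snd, e.snd * f.snd⟩⟩

instance : One (CocycleExt σ) := ⟨⟨-cocycleVal σ 1 1, 1⟩⟩

instance : Inv (CocycleExt σ) :=
  ⟨fun e => ⟨-e.fst - cocycleVal σ e.snd⁻¹ e.snd - cocycleVal σ 1 1, e.snd⁻¹⟩⟩

theorem mul_fst (e f : CocycleExt σ) :
    (e * f).fst = e.fst + f.fst + cocycleVal σ e.snd f.snd := rfl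

theorem mul_snd (e f : CocycleExt σ) : (e * f).snd = e.snd * f.snd := rfl

theorem one_fst : (1 : CocycleExt σ).fst = -cocycleVal σ 1 1 := rfl

theorem one_snd : (1 : CocycleExt σ).snd = 1 := rfl

theorem inv_fst (e : CocycleExt σ) :
    e⁻¹.fst = -e.fst - cocycleVal σ e.snd⁻¹ e.snd - cocycleVal σ 1 1 := rfl

theorem inv_snd (e : CocycleExt σ) : e⁻¹.snd = e.snd⁻¹ := rfl

theorem cocycleVal_one_left (g : Γ) : cocycleVal σ 1 g = cocycleVal σ 1 1 :=
  cocycles₂_map_one_fst σ g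

theorem cocycleVal_one_right (g : Γ) : cocycleVal σ g 1 = cocycleVal σ 1 1 :=
  cocycles₂_map_one_snd σ g

instance : Group (CocycleExt σ) :=
  Group.ofLeftAxioms
    (fun e f k => by
      ext
      · simp only [mul_fst, mul_snd]
        linarith [cocycleVal_mul_left σ e.snd f.snd k.snd]
      · exact mul_assoc _ _ _)
    (fun e => by
      ext
      · rw [mul_fst, one_fst, one_snd, cocycleVal_one_left e.snd]
        ring
      · exact one_mul _)
    (fun e => by
      ext
      · rw [mul_fst, inv_fst, inv_snd, one_fst]
        ring
      · exact inv_mul_cancel _)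

/-- The projection of the extension onto `Γ`. -/
def proj : CocycleExt σ →* Γ where
  toFun := snd
  map_one' := rfl
  map_mul' _ _ := rfl

/-- The central subgroup `ℤ` of the extension. -/
def incl : Multiplicative ℤ →* CocycleExt σ where
  toFun k := ⟨k.toAdd - cocycleVal σ 1 1, 1⟩
  map_one' := by
    ext
    · rw [toAdd_one, zero_sub, one_fst]
    · rfl
  map_mul' k l := by
    ext
    · rw [mul_fst, toAdd_mul]
      ring
    · exact (mul_one 1).symm

theorem incl_mul (k : Multiplicative ℤ) (e : CocycleExt σ) :
    incl k * e = ⟨k.toAdd + e.fst, e.snd⟩ := by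
  ext
  · change k.toAdd - cocycleVal σ 1 1 + e.fst + cocycleVal σ 1 e.snd = _
    rw [cocycleVal_one_left e.snd]
    ring
  · exact one_mul _

theorem mul_incl (k : Multiplicative ℤ) (e : CocycleExt σ) : e * incl k = incl k * e := by
  rw [incl_mul]
  ext
  · change e.fst + (k.toAdd - cocycleVal σ 1 1) + cocycleVal σ e.snd 1 = _
    rw [cocycleVal_one_right e.snd]
    ring
  · exact mul_one _

theorem incl_injective : Function.Injective (incl : Multiplicative ℤ →* CocycleExt σ) :=
  fun _ _ h => Multiplicative.toAdd.injective (sub_left_injective (congrArg fst h))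

theorem exists_eq_incl_mul_of_proj_eq {e f : CocycleExt σ} (h : proj e = proj f) :
    ∃ k, e = incl k * f := by
  refine ⟨Multiplicative.ofAdd (e.fst - f.fst), ?_⟩
  rw [incl_mul, toAdd_ofAdd, sub_add_cancel]
  exact CocycleExt.ext rfl h

theorem exists_lift_of_isSkinny {α : Γ →* Multiplicative ℤ}
    (hσ : IsSkinny α (H2π (trivialInt Γ) σ)) :
    ∃ s : α.ker →* CocycleExt σ, ∀ x, proj (s x) = x := by
  obtain ⟨b, hb⟩ := (isSkinny_H2π_iff α σ).1 hσ
  refine ⟨MonoidHom.mk' (fun x => ⟨-b x, x⟩) fun x y => CocycleExt.ext ?_ rfl, fun _ => rfl⟩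
  rw [mul_fst, ← hb, coboundary]
  ring

theorem exists_cocycle_of_section {T : Γ → CocycleExt σ} (hT : ∀ g, proj (T g) = g) :
    ∃ τ : cocycles₂ (trivialInt Γ), H2π (trivialInt Γ) τ = H2π (trivialInt Γ) σ ∧
      ∀ x y, T x * T y = incl (Multiplicative.ofAdd (cocycleVal τ x y)) * T (x * y) := by
  obtain ⟨δ, hδ⟩ := exists_coboundary_cocycle fun g => (T g).fst
  refine ⟨σ + δ, ?_, fun x y => ?_⟩
  · rw [map_add, add_eq_left, H2π_eq_zero_iff_exists_coboundary]
    exact ⟨_, fun x y => (hδ x y).symm⟩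
  have hsnd : ∀ g, (T g).snd = g := hT
  have hadd : cocycleVal (σ + δ) x y = cocycleVal σ x y + cocycleVal δ x y := rfl
  rw [incl_mul, toAdd_ofAdd, hadd, hδ, coboundary]
  ext
  · rw [mul_fst, hsnd, hsnd]
    ring
  · rw [mul_snd, hsnd, hsnd, hsnd]

end CocycleExt

end CentralExtension

section NewtonExpansion

variable {G A : Type*} [Group G] [CommGroup A]

/-- The difference operator `h ↦ (h ∘ ψ) / h` on homomorphisms to a commutative group. -/
def diffHom (ψ : G →* G) (h : G →* A) : G →* A :=
  h.comp ψ / h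

theorem mul_diffHom_apply (ψ : G →* G) (h : G →* A) (x : G) :
    h x * diffHom ψ h x = h (ψ x) :=
  mul_div_cancel _ _

/-- The Newton expansion `∏ᵢ (Δⁱ h)(x) ^ (l choose i + 1)`, with `Δ = diffHom ψ`, of the product
`h(x) h(ψ x) ⋯ h(ψˡ⁻¹ x)`, truncated at `i < N`. -/
def newtonProd (ψ : G →* G) (h : G →* A) (N : ℕ) (l : ℤ) (x : G) : A :=
  ∏ i ∈ Finset.range N, ((diffHom ψ)^[i] h) x ^ Ring.choose l (i + 1)

theorem newtonProd_zero (ψ : G →* G) (h : G →* A) (N : ℕ) (x : G) : newtonProd ψ h N 0 x = 1 :=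
  Finset.prod_eq_one fun i _ => by rw [Ring.choose_zero_succ, zpow_zero]

theorem newtonProd_add_one {ψ : G →* G} {h : G →* A} {N : ℕ} (hN : (diffHom ψ)^[N] h = 1) (l : ℤ)
    (x : G) : newtonProd ψ h N (l + 1) x = h x * newtonProd ψ h N l (ψ x) := by
  set Δ : ℕ → G →* A := fun i => (diffHom ψ)^[i] h
  have hshift : ∀ i, Δ i (ψ x) = Δ i x * Δ (i + 1) x := fun i => by
    simp only [Δ, Function.iterate_succ_apply', mul_diffHom_apply]
  have pascal : ∏ i ∈ Finset.range N, Δ i x ^ Ring.choose l i =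
      h x * ∏ i ∈ Finset.range N, Δ (i + 1) x ^ Ring.choose l (i + 1) := by
    have htop : Δ N x = 1 := DFunLike.congr_fun hN x
    have hsplit := Finset.prod_range_succ (fun i => Δ i x ^ Ring.choose l i) N
    rw [Finset.prod_range_succ', htop, one_zpow, mul_one, Ring.choose_zero_right,
      zpow_one] at hsplit
    rw [← hsplit, mul_comm]
    rfl
  change ∏ i ∈ Finset.range N, Δ i x ^ Ring.choose (l + 1) (i + 1) =
    h x * ∏ i ∈ Finset.range N, Δ i (ψ x) ^ Ring.choose l (i + 1)
  simp only [Ring.choose_succ_succ, zpow_add, hshift, mul_zpow, Finset.prod_mul_distrib, pascal]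
  rw [mul_assoc, mul_comm (∏ i ∈ Finset.range N, Δ (i + 1) x ^ _)]

variable {E : Type*} [Group E]

theorem zpow_neg_mul_mul_zpow_eq_newtonProd {s : G →* E} {z : A →* E}
    (hz : ∀ k e, e * z k = z k * e) {t : E} {ψ : MulAut G} {h : G →* A}
    (hconj : ∀ x, t⁻¹ * s x * t = z (h x) * s (ψ x)) {N : ℕ}
    (hN : (diffHom ψ.toMonoidHom)^[N] h = 1) (l : ℤ) (x : G) :
    t ^ (-l) * s x * t ^ l = z (newtonProd ψ.toMonoidHom h N l x) * s ((ψ ^ l) x) := by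
  have hleft : ∀ (k : ℤ) (x : G), t ^ (-(k + 1)) * s x * t ^ (k + 1) =
      z (h x) * (t ^ (-k) * s (ψ x) * t ^ k) := fun k x =>
    calc t ^ (-(k + 1)) * s x * t ^ (k + 1) = t ^ (-k) * (t⁻¹ * s x * t) * t ^ k := by group
      _ = t ^ (-k) * z (h x) * s (ψ x) * t ^ k := by rw [hconj, ← mul_assoc (t ^ (-k))]
      _ = _ := by rw [hz]; group
  have hright : ∀ (k : ℤ) (x : G),
      z (newtonProd ψ.toMonoidHom h N (k + 1) x) * s ((ψ ^ (k + 1)) x) =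
        z (h x) * (z (newtonProd ψ.toMonoidHom h N k (ψ x)) * s ((ψ ^ k) (ψ x))) := fun k x => by
    rw [newtonProd_add_one hN, map_mul, mul_assoc, zpow_add_one]
    rfl
  induction l using Int.induction_on generalizing x with
  | zero => simp [newtonProd_zero]
  | succ k ih => rw [hleft, hright, ih]
  | pred k ih =>
    obtain ⟨y, rfl⟩ := ψ.surjective x
    have hy := ih y
    rw [show (-(k : ℤ)) = (-k - 1) + 1 by ring, hleft, hright] at hy
    exact mul_left_cancel hy

theorem exists_hom_of_conj_eq {s : G →* E} {z : A →* E} (hz : ∀ k e, e * z k = z k * e)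
    (hinj : Function.Injective z) {t : E} {ψ : G →* G}
    (hconj : ∀ x, ∃ k, t⁻¹ * s x * t = z k * s (ψ x)) :
    ∃ h : G →* A, ∀ x, t⁻¹ * s x * t = z (h x) * s (ψ x) := by
  choose h hh using hconj
  refine ⟨MonoidHom.mk' h fun x y => hinj (mul_right_cancel (b := s (ψ (x * y))) ?_), hh⟩
  calc z (h (x * y)) * s (ψ (x * y)) = (t⁻¹ * s x * t) * (t⁻¹ * s y * t) := by
        rw [← hh, map_mul]; group
    _ = z (h x) * (s (ψ x) * z (h y)) * s (ψ y) := by rw [hh, hh]; group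
    _ = z (h x * h y) * s (ψ (x * y)) := by rw [hz, map_mul, map_mul, map_mul]; group

end NewtonExpansion

section Nilpotent

variable {Γ : Type*} [Group Γ]

/-- Each difference under conjugation by `a` gains one step of a descending central series, because
`a⁻¹ x a x⁻¹` is a commutator. -/
theorem exists_iterate_diffHom_conjNormal_eq_one [Group.IsNilpotent Γ] {A : Type*} [CommGroup A]
    (Λ : Subgroup Γ) [Λ.Normal] (a : Γ) (h : Λ →* A) :
    ∃ N, (diffHom (MulAut.conjNormal a : MulAut Λ).toMonoidHom)^[N] h = 1 := by
  obtain ⟨M, H, ⟨hH0, hH⟩, hHM⟩ :=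
    (Subgroup.nilpotent_iff_finite_descending_central_series Γ).1 inferInstance
  have key : ∀ i ≤ M, ∀ x : Λ, (x : Γ) ∈ H (M - i) →
      (diffHom (MulAut.conjNormal a : MulAut Λ).toMonoidHom)^[i] h x = 1 := by
    intro i
    induction i with
    | zero =>
      intro _ x hx
      rw [Nat.sub_zero, hHM, Subgroup.mem_bot] at hx
      rw [show x = 1 from Subtype.ext hx, map_one]
    | succ i ih =>
      intro hi x hx
      have hdiff : (diffHom (MulAut.conjNormal a : MulAut Λ).toMonoidHom)^[i + 1] h x =
          (diffHom (MulAut.conjNormal a : MulAut Λ).toMonoidHom)^[i] h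
            (MulAut.conjNormal a x * x⁻¹) := by
        rw [Function.iterate_succ_apply', map_mul, map_inv (_^[i] h), ← div_eq_mul_inv]
        rfl
      rw [hdiff]
      refine ih (by omega) _ ?_
      have hcomm := (H (M - (i + 1) + 1)).inv_mem (hH x _ hx a)
      rw [show M - (i + 1) + 1 = M - i by omega] at hcomm
      convert hcomm using 1
      push_cast
      rw [MulAut.conjNormal_apply, commutatorElement_def]
      group
  refine ⟨M, MonoidHom.ext fun x => key M le_rfl x ?_⟩
  rw [Nat.sub_self, hH0]
  exact Subgroup.mem_top _

end Nilpotent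

section SplitHom

variable {Γ : Type*} [Group Γ] {α : Γ →* Multiplicative ℤ} {a : Γ}

theorem toAdd_map_zpow_mul_ker (ha : α a = Multiplicative.ofAdd 1) (k : ℤ) (x : α.ker) :
    (α (a ^ k * x)).toAdd = k := by
  rw [map_mul, map_zpow, ha, MonoidHom.mem_ker.1 x.2]
  simp

theorem exists_eq_zpow_mul_ker (ha : α a = Multiplicative.ofAdd 1) (g : Γ) :
    ∃ (k : ℤ) (x : α.ker), g = a ^ k * x := by
  refine ⟨(α g).toAdd, ⟨a ^ (-(α g).toAdd) * g, ?_⟩, by group⟩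
  rw [MonoidHom.mem_ker, map_mul, map_zpow, ha]
  exact Multiplicative.toAdd.injective (by simp)

theorem exists_forall_zpow_mul_ker_eq (ha : α a = Multiplicative.ofAdd 1) {E : Type*}
    (F : ℤ → α.ker → E) : ∃ T : Γ → E, ∀ (k : ℤ) (x : α.ker), T (a ^ k * x) = F k x := by
  choose κ ξ hκξ using exists_eq_zpow_mul_ker ha
  refine ⟨fun g => F (κ g) (ξ g), fun k x => ?_⟩
  have hκ : κ (a ^ k * x) = k := by
    rw [← toAdd_map_zpow_mul_ker ha (κ _) (ξ _), ← hκξ, toAdd_map_zpow_mul_ker ha]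
  have hξ : ξ (a ^ k * x) = x := by
    have h := hκξ (a ^ k * x)
    rw [hκ] at h
    exact Subtype.ext (mul_left_cancel h).symm
  change F (κ (a ^ k * x)) (ξ (a ^ k * x)) = F k x
  rw [hκ, hξ]

theorem exists_split_of_ne_one (hα : α ≠ 1) :
    ∃ (β : Γ →* Multiplicative ℤ) (a : Γ), β a = Multiplicative.ofAdd 1 ∧ β.ker = α.ker := by
  have hnontrivial : Nontrivial α.range :=
    (Subgroup.nontrivial_iff_ne_bot _).2 (mt MonoidHom.range_eq_bot_iff.1 hα)
  have hinfinite : Infinite α.range := inferInstance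
  let e : α.range ≃* Multiplicative ℤ := intCyclicMulEquiv.symm
  obtain ⟨a, ha⟩ := (e.surjective.comp α.rangeRestrict_surjective) (Multiplicative.ofAdd 1)
  refine ⟨e.toMonoidHom.comp α.rangeRestrict, a, ha, ?_⟩
  rw [MonoidHom.ker_comp_of_injective _ _ e.injective, MonoidHom.ker_rangeRestrict]

end SplitHom

section NewtonCocycle

open groupCohomology

variable {Γ : Type} [Group Γ] {α : Γ →* Multiplicative ℤ} {a : Γ}

theorem exists_newtonProd_cocycle [Group.IsNilpotent Γ] (ha : α a = Multiplicative.ofAdd 1)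
    {c : H2 (trivialInt Γ)} (hc : IsSkinny α c) :
    ∃ σ : cocycles₂ (trivialInt Γ), H2π (trivialInt Γ) σ = c ∧
      ∃ (ψ : α.ker →* α.ker) (h : α.ker →* Multiplicative ℤ) (N : ℕ), ∀ (k l : ℤ) (x y : α.ker),
        cocycleVal σ (a ^ k * x) (a ^ l * y) = (newtonProd ψ h N l x).toAdd := by
  induction c using H2_induction_on with | h σ => ?_
  obtain ⟨s, hs⟩ := CocycleExt.exists_lift_of_isSkinny hc
  obtain ⟨t, ht⟩ : ∃ t : CocycleExt σ, t.proj = a := ⟨⟨0, a⟩, rfl⟩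
  set ψ : MulAut α.ker := MulAut.conjNormal a⁻¹
  have coe_ψ_zpow : ∀ (l : ℤ) (x : α.ker), ((ψ ^ l) x : Γ) = a ^ (-l) * x * a ^ l := by
    intro l x
    rw [← map_zpow, MulAut.conjNormal_apply]
    group
  obtain ⟨h, hconj⟩ := exists_hom_of_conj_eq (s := s) CocycleExt.mul_incl CocycleExt.incl_injective
    (t := t) (ψ := ψ.toMonoidHom) fun x => CocycleExt.exists_eq_incl_mul_of_proj_eq <| by
      simpa [hs, ht] using (coe_ψ_zpow 1 x).symm
  obtain ⟨N, hN⟩ := exists_iterate_diffHom_conjNormal_eq_one α.ker a⁻¹ h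
  obtain ⟨T, hT⟩ := exists_forall_zpow_mul_ker_eq ha fun k x => t ^ k * s x
  have hprojT : ∀ g, CocycleExt.proj (T g) = g := by
    intro g
    obtain ⟨k, x, rfl⟩ := exists_eq_zpow_mul_ker ha g
    rw [hT, map_mul, map_zpow, ht, hs]
  obtain ⟨τ, hτ, hτmul⟩ := CocycleExt.exists_cocycle_of_section hprojT
  refine ⟨τ, hτ, ψ.toMonoidHom, h, N, fun k l x y => ?_⟩
  have hmul : a ^ k * x * (a ^ l * y) = a ^ (k + l) * (((ψ ^ l) x * y : α.ker) : Γ) := by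
    rw [Subgroup.coe_mul, coe_ψ_zpow]
    group
  have hTmul : T (a ^ k * x) * T (a ^ l * y) =
      CocycleExt.incl (newtonProd ψ.toMonoidHom h N l x) * T (a ^ k * x * (a ^ l * y)) :=
    calc T (a ^ k * x) * T (a ^ l * y) = t ^ (k + l) * (t ^ (-l) * s x * t ^ l) * s y := by
          rw [hT, hT]; group
      _ = t ^ (k + l) * CocycleExt.incl (newtonProd ψ.toMonoidHom h N l x) * s ((ψ ^ l) x * y) := by
          rw [zpow_neg_mul_mul_zpow_eq_newtonProd CocycleExt.mul_incl hconj hN, map_mul]; group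
      _ = _ := by rw [CocycleExt.mul_incl, hmul, hT, mul_assoc]
  rw [hτmul] at hTmul
  exact congrArg Multiplicative.toAdd (CocycleExt.incl_injective (mul_right_cancel hTmul))

end NewtonCocycle

section Periodicity

theorem intCast_choose_eq {n k : ℕ} (hn : n.Coprime k.factorial) {l l' : ℤ}
    (h : (l : ZMod n) = l') : ((Ring.choose l k : ℤ) : ZMod n) = (Ring.choose l' k : ℤ) := by
  have hunit : IsUnit (k.factorial : ZMod n) := (ZMod.isUnit_iff_coprime _ _).2 hn.symm
  have hpoly (r : ℤ) : (k.factorial : ZMod n) * (Ring.choose r k : ℤ) =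
      (descPochhammer (ZMod n) k).eval (r : ZMod n) := by
    rw [← descPochhammer_map (Int.castRingHom (ZMod n)), Polynomial.eval_intCast_map, Int.cast_id,
      Polynomial.eval_eq_smeval, Ring.descPochhammer_eq_factorial_smul_choose]
    simp
  exact hunit.mul_left_cancel (by rw [hpoly, hpoly, h])

theorem toAdd_newtonProd {G : Type*} [Group G] (ψ : G →* G) (h : G →* Multiplicative ℤ) (N : ℕ)
    (l : ℤ) (x : G) : (newtonProd ψ h N l x).toAdd =
      ∑ i ∈ Finset.range N, Ring.choose l (i + 1) * ((diffHom ψ)^[i] h x).toAdd := by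
  simp [newtonProd, toAdd_prod]

theorem intCast_toAdd_newtonProd_eq {G : Type*} [Group G] (ψ : G →* G)
    (h : G →* Multiplicative ℤ) {n N : ℕ} (hn : n.Coprime N.factorial) {l l' : ℤ}
    (hl : (l : ZMod n) = l') (x : G) :
    ((newtonProd ψ h N l x).toAdd : ZMod n) = (newtonProd ψ h N l' x).toAdd := by
  rw [toAdd_newtonProd, toAdd_newtonProd]
  push_cast
  refine Finset.sum_congr rfl fun i hi => ?_
  have hcop : n.Coprime (i + 1).factorial :=
    hn.coprime_dvd_right (Nat.factorial_dvd_factorial (Finset.mem_range.1 hi))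
  rw [intCast_choose_eq hcop hl]

theorem isPeriodicMod_of_eq_newtonProd {Γ : Type*} [Group Γ] {α : Γ →* Multiplicative ℤ} {a : Γ}
    (ha : α a = Multiplicative.ofAdd 1) {σ : Γ → Γ → ℤ} {ψ : α.ker →* α.ker}
    {h : α.ker →* Multiplicative ℤ} {n N : ℕ} (hσ : ∀ (k l : ℤ) (x y : α.ker),
      σ (a ^ k * x) (a ^ l * y) = (newtonProd ψ h N l x).toAdd)
    (hn : n.Coprime N.factorial) : IsPeriodicMod n α σ := by
  intro g h h' hh
  obtain ⟨k, x, rfl⟩ := exists_eq_zpow_mul_ker ha g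
  obtain ⟨l, y, rfl⟩ := exists_eq_zpow_mul_ker ha h
  obtain ⟨l', y', rfl⟩ := exists_eq_zpow_mul_ker ha h'
  rw [toAdd_map_zpow_mul_ker ha, toAdd_map_zpow_mul_ker ha] at hh
  rw [hσ, hσ, intCast_toAdd_newtonProd_eq _ _ hn hh]

end Periodicity

section NotStable

open groupCohomology

variable {Γ : Type} [Group Γ] {α : Γ →* Multiplicative ℤ} {a : Γ} {σ : cocycles₂ (trivialInt Γ)}
  {n : ℕ → ℕ} [∀ i, NeZero (n i)]

theorem isFrobeniusAsymptoticRep_cocycleShift (ha : α a = Multiplicative.ofAdd 1)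
    (hn : Tendsto n atTop atTop) (hσ : ∀ i, IsPeriodicMod (n i) α (cocycleVal σ)) :
    IsFrobeniusAsymptoticRep fun i => cocycleShift (n i) α a (cocycleVal σ) :=
  isFrobeniusAsymptoticRep_of_isProjectiveRep (by simpa only [ZMod.card] using hn) fun i => by
    simpa only [ZMod.card] using isProjectiveRep_cocycleShift ha (hσ i) (cocycleVal_mul_left σ)

theorem not_isOpNormPerturbable_cocycleShift [Group.FG Γ] (ha : α a = Multiplicative.ofAdd 1)
    (hn : Tendsto n atTop atTop) (hσ : ∀ i, IsPeriodicMod (n i) α (cocycleVal σ))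
    (hct : ¬ IsOfFinAddOrder (H2π (trivialInt Γ) σ)) :
    ¬ IsOpNormPerturbable fun i => cocycleShift (n i) α a (cocycleVal σ) := by
  intro hpert
  obtain ⟨D, hD, b, hb⟩ := exists_int_coboundary_eq_mul_of_isOpNormPerturbable
    (σ := cocycleVal σ) (by simpa only [ZMod.card] using hn) (fun i => by
      simpa only [ZMod.card] using isProjectiveRep_cocycleShift ha (hσ i) (cocycleVal_mul_left σ))
    hpert
  exact hct (isOfFinAddOrder_H2π hD hb)

theorem not_frobeniusStable_of_isSkinny [Group.FG Γ] [Group.IsNilpotent Γ]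
    {c : H2 (trivialInt Γ)} (hc : IsSkinny α c) (hct : ¬ IsOfFinAddOrder c) :
    ¬ FrobeniusStable Γ := by
  intro hstable
  have hα : α ≠ 1 := by
    rintro rfl
    exact hct (hc.eq_zero ▸ IsOfFinAddOrder.zero)
  obtain ⟨β, a, ha, hker⟩ := exists_split_of_ne_one hα
  obtain ⟨σ, rfl, ψ, h, N, hσ⟩ := exists_newtonProd_cocycle ha (hc.of_ker_eq hker)
  let n : ℕ → ℕ := fun i => i * N.factorial + 1
  have hn : Tendsto n atTop atTop := tendsto_atTop_mono
    (fun i => (Nat.le_mul_of_pos_right i N.factorial_pos).trans (Nat.le_succ _)) tendsto_id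
  have hper (i : ℕ) : IsPeriodicMod (n i) β (cocycleVal σ) :=
    isPeriodicMod_of_eq_newtonProd ha hσ (by simp [n])
  have hpert : IsFrobeniusPerturbable fun i => cocycleShift (n i) β a (cocycleVal σ) :=
    hstable n _ (isFrobeniusAsymptoticRep_cocycleShift ha hn hper)
  exact not_isOpNormPerturbable_cocycleShift ha hn hper hct hpert.isOpNormPerturbable

end NotStable

section MalcevCoordinates

variable {Γ : Type*} [Group Γ] {m : ℕ}

theorem IsMalcevBasis.surjective_canonicalForm {a : Fin m → Γ} (ha : IsMalcevBasis a) :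
    Function.Surjective (canonicalForm a) := fun g =>
  (ha.existsUnique_form g).exists.imp fun _ => Eq.symm

theorem canonicalForm_zero (a : Fin m → Γ) : canonicalForm a 0 = 1 :=
  List.prod_eq_one <| by simp

theorem canonicalForm_eq_mul_tail (a : Fin (m + 1) → Γ) (x : Fin (m + 1) → ℤ) :
    canonicalForm a x = a 0 ^ x 0 * canonicalForm (Fin.tail a) (Fin.tail x) := by
  rw [canonicalForm, List.ofFn_succ, List.prod_cons]
  rfl

theorem canonicalForm_single (a : Fin m → Γ) (k : Fin m) (j : ℤ) :
    canonicalForm a (Pi.single k j) = a k ^ j := by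
  induction m with
  | zero => exact k.elim0
  | succ m ih =>
    rw [canonicalForm_eq_mul_tail]
    induction k using Fin.cases with
    | zero =>
      have htail : Fin.tail (Pi.single 0 j : Fin (m + 1) → ℤ) = 0 :=
        funext fun i => Pi.single_eq_of_ne (Fin.succ_ne_zero i) j
      rw [htail, canonicalForm_zero, mul_one, Pi.single_eq_same]
    | succ k =>
      have htail : Fin.tail (Pi.single k.succ j : Fin (m + 1) → ℤ) = Pi.single k j := by
        ext i
        simp [Fin.tail, Pi.single_apply]
      rw [htail, ih, Pi.single_eq_of_ne (Fin.succ_ne_zero k).symm, zpow_zero, one_mul, Fin.tail]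

theorem map_canonicalForm {G : Type*} [Group G] (f : Γ →* G) (a : Fin m → Γ) (x : Fin m → ℤ) :
    f (canonicalForm a x) = canonicalForm (f ∘ a) x := by
  rw [canonicalForm, map_list_prod, List.map_ofFn, canonicalForm]
  exact congrArg (fun v => (List.ofFn v).prod) (funext fun i => map_zpow f (a i) (x i))

theorem toAdd_map_canonicalForm (f : Γ →* Multiplicative ℤ) (a : Fin m → Γ) (x : Fin m → ℤ) :
    (f (canonicalForm a x)).toAdd = ∑ k, x k * (f (a k)).toAdd := by
  rw [map_canonicalForm, canonicalForm, List.prod_ofFn, toAdd_prod]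
  simp

variable {a : Fin (m + 1) → Γ} {α : Γ →* Multiplicative ℤ}

theorem IsCanonicalHom.apply_zero (hα : IsCanonicalHom a α) :
    α (a 0) = Multiplicative.ofAdd 1 := by
  rw [← zpow_one (a 0), ← canonicalForm_single, hα, Pi.single_eq_same]

theorem IsCanonicalHom.apply_succ (hα : IsCanonicalHom a α) (k : Fin m) : α (a k.succ) = 1 := by
  rw [← zpow_one (a k.succ), ← canonicalForm_single, hα,
    Pi.single_eq_of_ne (Fin.succ_ne_zero k).symm, ofAdd_zero]

theorem IsCanonicalHom.exists_canonicalForm_eq_mul_ker (hα : IsCanonicalHom a α) :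
    ∃ b : Fin m → α.ker, ∀ x : Fin (m + 1) → ℤ,
      canonicalForm a x = a 0 ^ x 0 * (canonicalForm b (Fin.tail x) : α.ker) := by
  refine ⟨fun k => ⟨a k.succ, hα.apply_succ k⟩, fun x => ?_⟩
  rw [canonicalForm_eq_mul_tail, ← Subgroup.coe_subtype, map_canonicalForm]
  rfl

end MalcevCoordinates

section Polynomial

open groupCohomology MvPolynomial

theorem exists_map_intCast_eq_C_mul {τ : Type*} {p : MvPolynomial τ ℚ} {n : ℕ}
    (hn : ∀ s, n.Coprime (p.coeff s).den) :
    ∃ D : ℕ, D.Coprime n ∧ ∃ q : MvPolynomial τ ℤ, map (Int.castRingHom ℚ) q = C (D : ℚ) * p := by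
  refine ⟨∏ s ∈ p.support, (p.coeff s).den, Nat.Coprime.prod_left fun s _ => (hn s).symm, ?_⟩
  refine mem_range_map_iff_coeffs_subset.2 fun r hr => ?_
  obtain ⟨s, hs, rfl⟩ := mem_coeffs_iff.1 hr
  rw [coeff_C_mul]
  have hsp : s ∈ p.support := by
    rw [mem_support_iff, coeff_C_mul] at hs
    exact mem_support_iff.2 (right_ne_zero_of_mul hs)
  obtain ⟨e, he⟩ := Finset.dvd_prod_of_mem (fun s => (p.coeff s).den) hsp
  refine ⟨e * (p.coeff s).num, ?_⟩
  rw [he, eq_intCast, Int.cast_mul, ← Rat.mul_den_eq_num]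
  push_cast
  ring

theorem intCast_eq_of_eq_eval {τ : Type*} {p : MvPolynomial τ ℚ} {n : ℕ}
    (hn : ∀ s, n.Coprime (p.coeff s).den) {v v' : τ → ℤ} (hv : ∀ o, (v o : ZMod n) = v' o)
    {k k' : ℤ} (hk : (k : ℚ) = eval (fun o => (v o : ℚ)) p)
    (hk' : (k' : ℚ) = eval (fun o => (v' o : ℚ)) p) : (k : ZMod n) = k' := by
  obtain ⟨D, hD, q, hq⟩ := exists_map_intCast_eq_C_mul hn
  have hint {w : τ → ℤ} {r : ℤ} (hr : (r : ℚ) = eval (fun o => (w o : ℚ)) p) :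
      D * r = aeval w q := by
    have hrat : (aeval (fun o => (w o : ℚ)) q : ℚ) = D * r := by
      rw [hr, ← aeval_map_algebraMap ℚ, algebraMap_int_eq, hq, aeval_eq_eval, map_mul, eval_C]
    have hcast : ((aeval w q : ℤ) : ℚ) = D * r := (aeval_algebraMap_apply ℚ w q).symm.trans hrat
    exact_mod_cast hcast.symm
  have hmod {w : τ → ℤ} {r : ℤ} (hr : (r : ℚ) = eval (fun o => (w o : ℚ)) p) :
      (D * r : ZMod n) = aeval (fun o => (w o : ZMod n)) q := by
    refine .trans ?_ (aeval_algebraMap_apply (ZMod n) w q).symm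
    rw [← hint hr]
    simp
  refine ((ZMod.isUnit_iff_coprime D n).2 hD).mul_left_cancel ?_
  rw [hmod hk, hmod hk', funext hv]

theorem polyVal_eq_eval_intCast {m : ℕ} (p : MvPolynomial (Option (Fin (m + 1))) ℚ)
    (x : Fin (m + 1) → ℤ) (j : ℤ) : polyVal p x j = eval (fun o => ((o.elim j x : ℤ) : ℚ)) p := by
  rw [polyVal]
  congr
  ext o
  cases o <;> rfl

theorem exists_polyVal_eq_newtonProd {G : Type*} [Group G] {m : ℕ} (ψ : G →* G)
    (h : G →* Multiplicative ℤ) (N : ℕ) (b : Fin m → G) :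
    ∃ p : MvPolynomial (Option (Fin (m + 1))) ℚ, ∀ (x : Fin (m + 1) → ℤ) (j : ℤ),
      ((newtonProd ψ h N j (canonicalForm b (Fin.tail x))).toAdd : ℚ) = polyVal p x j := by
  refine ⟨∑ i ∈ Finset.range N, Ring.choose (X none) (i + 1) *
    ∑ k, X (some k.succ) * C (((diffHom ψ)^[i] h (b k)).toAdd : ℚ), fun x j => ?_⟩
  have hchoose (i : ℕ) : ((Ring.choose j i : ℤ) : ℚ) = Ring.choose (j : ℚ) i :=
    Ring.map_choose (Int.castRingHom ℚ) j i
  simp [toAdd_newtonProd, polyVal, toAdd_map_canonicalForm, Ring.map_choose, hchoose, Fin.tail]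

variable {Γ : Type} [Group Γ] {m : ℕ} {a : Fin (m + 1) → Γ} {α : Γ →* Multiplicative ℤ}

theorem isNormalized_of_eq_newtonProd {a : Γ} (ha : α a = Multiplicative.ofAdd 1)
    {σ : cocycles₂ (trivialInt Γ)} {ψ : α.ker →* α.ker} {h : α.ker →* Multiplicative ℤ} {N : ℕ}
    (hσ : ∀ (k l : ℤ) (x y : α.ker),
      cocycleVal σ (a ^ k * x) (a ^ l * y) = (newtonProd ψ h N l x).toAdd) : IsNormalized σ := by
  intro g
  obtain ⟨k, x, rfl⟩ := exists_eq_zpow_mul_ker ha g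
  constructor
  · simpa [newtonProd_zero] using hσ k 0 x 1
  · simpa [newtonProd] using hσ 0 k 1 x

theorem exists_polynomial_cocycle [Group.IsNilpotent Γ] (hα : IsCanonicalHom a α)
    {c : H2 (trivialInt Γ)} (hc : IsSkinny α c) :
    ∃ (σ : cocycles₂ (trivialInt Γ)) (p : MvPolynomial (Option (Fin (m + 1))) ℚ),
      H2π (trivialInt Γ) σ = c ∧ IsNormalized σ ∧ IsGivenBy a σ p := by
  obtain ⟨σ, hσc, ψ, h, N, hσ⟩ := exists_newtonProd_cocycle hα.apply_zero hc
  obtain ⟨b, hb⟩ := hα.exists_canonicalForm_eq_mul_ker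
  obtain ⟨p, hp⟩ := exists_polyVal_eq_newtonProd ψ h N b
  refine ⟨σ, p, hσc, isNormalized_of_eq_newtonProd hα.apply_zero hσ, fun x y => ?_⟩
  rw [hb x, hb y, hσ, hp]

variable {σ : cocycles₂ (trivialInt Γ)} {p : MvPolynomial (Option (Fin (m + 1))) ℚ}

theorem IsGivenBy.isPeriodicMod (hp : IsGivenBy a σ p)
    (ha : Function.Surjective (canonicalForm a)) (hα : IsCanonicalHom a α) {n : ℕ}
    (hn : CoprimeToDenominators p n) : IsPeriodicMod n α (cocycleVal σ) := by
  intro g h h' hh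
  obtain ⟨x, rfl⟩ := ha g
  obtain ⟨y, rfl⟩ := ha h
  obtain ⟨y', rfl⟩ := ha h'
  rw [hα, hα] at hh
  refine intCast_eq_of_eq_eval hn (v := fun o => o.elim (y 0) x) (v' := fun o => o.elim (y' 0) x)
    ?_ ((hp x y).trans (polyVal_eq_eval_intCast p x _))
    ((hp x y').trans (polyVal_eq_eval_intCast p x _))
  rintro (_ | i)
  exacts [hh, rfl]

theorem isCocycleMap_iff (hp : IsGivenBy a σ p) (ha : Function.Surjective (canonicalForm a))
    (hα : IsCanonicalHom a α) {n : ℕ} [NeZero n] (hn : CoprimeToDenominators p n)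
    {ρ : Γ → Matrix.unitaryGroup (ZMod n) ℂ} :
    IsCocycleMap a p n ρ ↔ ρ = cocycleShift n α (a 0) (cocycleVal σ) := by
  have hformula (x : Fin (m + 1) → ℤ) (j : ℤ) :
      (cocycleShift n α (a 0) (cocycleVal σ) (canonicalForm a x)).1.mulVec
          (Pi.single (j : ZMod n) 1) =
        Complex.exp (2 * Real.pi * Complex.I / n * (polyVal p x j : ℂ)) •
          Pi.single ((j : ZMod n) + (x 0 : ZMod n)) (1 : ℂ) := by
    have hval := hp x (Pi.single 0 j)
    have hcol := cocycleShift_mulVec_single hα.apply_zero (hp.isPeriodicMod ha hα hn)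
      (canonicalForm a x) (canonicalForm a (Pi.single 0 j))
    rw [Pi.single_eq_same] at hval
    rw [hα, hα, toAdd_ofAdd, toAdd_ofAdd, Pi.single_eq_same, ZMod.toCircle_intCast] at hcol
    rw [hcol, ← hval, Rat.cast_intCast, div_mul_eq_mul_div]
  refine ⟨fun hρ => funext fun g => Subtype.ext ?_, ?_⟩
  · obtain ⟨x, rfl⟩ := ha g
    refine Matrix.ext_of_mulVec_single fun j => ?_
    obtain ⟨j, rfl⟩ := ZMod.intCast_surjective j
    rw [hρ, hformula]
  · rintro rfl
    exact hformula

end Polynomial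

end

end SkinnyClass

open SkinnyClass in
theorem mainTheorem3_general {Γ : Type} [Group Γ] [Group.FG Γ] [Group.IsNilpotent Γ] :
    ((∃ (α : Γ →* Multiplicative ℤ) (c : groupCohomology.H2 (trivialInt Γ)),
        IsSkinny α c ∧ ¬ IsOfFinAddOrder c) → ¬ FrobeniusStable Γ) ∧
    (∀ (m : ℕ) (a : Fin (m + 1) → Γ), Function.Surjective (canonicalForm a) →
      ∀ α : Γ →* Multiplicative ℤ, IsCanonicalHom a α →
      ∀ c : groupCohomology.H2 (trivialInt Γ), IsSkinny α c → ¬ IsOfFinAddOrder c →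
        (∃ (σ : groupCohomology.cocycles₂ (trivialInt Γ))
            (p : MvPolynomial (Option (Fin (m + 1))) ℚ),
          groupCohomology.H2π (trivialInt Γ) σ = c ∧ IsNormalized σ ∧ IsGivenBy a σ p) ∧
        ∀ (σ : groupCohomology.cocycles₂ (trivialInt Γ))
            (p : MvPolynomial (Option (Fin (m + 1))) ℚ),
          groupCohomology.H2π (trivialInt Γ) σ = c → IsGivenBy a σ p →
          (∀ (n : ℕ) [NeZero n], CoprimeToDenominators p n →
            ∃! ρ : Γ → Matrix.unitaryGroup (ZMod n) ℂ, IsCocycleMap a p n ρ) ∧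
          ∀ (n : ℕ → ℕ) [∀ i, NeZero (n i)], Tendsto n atTop atTop →
            (∀ i, CoprimeToDenominators p (n i)) →
            ∀ ρ : ∀ i, Γ → Matrix.unitaryGroup (ZMod (n i)) ℂ,
              (∀ i, IsCocycleMap a p (n i) (ρ i)) →
              IsFrobeniusAsymptoticRep ρ ∧ ¬ IsFrobeniusPerturbable ρ ∧
                ¬ IsOpNormPerturbable ρ) := by
  refine ⟨fun ⟨_, _, hc, hct⟩ => not_frobeniusStable_of_isSkinny hc hct, ?_⟩
  intro m a ha α hα c hc hct
  refine ⟨exists_polynomial_cocycle hα hc, ?_⟩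
  rintro σ p rfl hp
  refine ⟨fun n _ hn => ⟨_, (isCocycleMap_iff hp ha hα hn).2 rfl, fun _ =>
    (isCocycleMap_iff hp ha hα hn).1⟩, fun n _ htop hn ρ hρ => ?_⟩
  obtain rfl : ρ = fun i => cocycleShift (n i) α (a 0) (cocycleVal σ) :=
    funext fun i => (isCocycleMap_iff hp ha hα (hn i)).1 (hρ i)
  have hper i := hp.isPeriodicMod ha hα (hn i)
  have hop := not_isOpNormPerturbable_cocycleShift hα.apply_zero htop hper hct
  exact ⟨isFrobeniusAsymptoticRep_cocycleShift hα.apply_zero htop hper,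
    fun hpert => hop hpert.isOpNormPerturbable, hop⟩

open SkinnyClass in
theorem mainTheorem3 {Γ : Type} [Group Γ] [Group.FG Γ] [Group.IsNilpotent Γ]
    (htf : ∀ g : Γ, g ≠ 1 → ¬ IsOfFinOrder g) :
    -- a non-torsion skinny class (with respect to any homomorphism to `ℤ`) obstructs stability
    ((∃ (α : Γ →* Multiplicative ℤ) (c : groupCohomology.H2 (trivialInt Γ)),
        IsSkinny α c ∧ ¬ IsOfFinAddOrder c) → ¬ FrobeniusStable Γ) ∧
    -- the explicit sequence
    (∀ (m : ℕ) (a : Fin (m + 1) → Γ), IsMalcevBasis a →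
      ∀ α : Γ →* Multiplicative ℤ, IsCanonicalHom a α →
      ∀ c : groupCohomology.H2 (trivialInt Γ), IsSkinny α c → ¬ IsOfFinAddOrder c →
        -- there is a polynomial representative
        (∃ (σ : groupCohomology.cocycles₂ (trivialInt Γ))
            (p : MvPolynomial (Option (Fin (m + 1))) ℚ),
          groupCohomology.H2π (trivialInt Γ) σ = c ∧ IsNormalized σ ∧ IsGivenBy a σ p) ∧
        -- and for every polynomial representative
        ∀ (σ : groupCohomology.cocycles₂ (trivialInt Γ))
            (p : MvPolynomial (Option (Fin (m + 1))) ℚ),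
          groupCohomology.H2π (trivialInt Γ) σ = c → IsGivenBy a σ p →
          -- the formula for `ρ_n` is well defined
          (∀ (n : ℕ) [NeZero n], CoprimeToDenominators p n →
            ∃! ρ : Γ → Matrix.unitaryGroup (ZMod n) ℂ, IsCocycleMap a p n ρ) ∧
          -- and along the admissible `n → ∞` it is a non-perturbable asymptotic representation
          ∀ (n : ℕ → ℕ) [∀ i, NeZero (n i)], StrictMono n →
            (∀ i, CoprimeToDenominators p (n i)) →
            ∀ ρ : ∀ i, Γ → Matrix.unitaryGroup (ZMod (n i)) ℂ,
              (∀ i, IsCocycleMap a p (n i) (ρ i)) →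
              IsFrobeniusAsymptoticRep ρ ∧ ¬ IsFrobeniusPerturbable ρ ∧
                ¬ IsOpNormPerturbable ρ) := by
  exact mainTheorem3_general.imp_right fun h m a ha α hα c hc hct =>
    (h m a ha.surjective_canonicalForm α hα c hc hct).imp_right fun h σ p hσ hp =>
      (h σ p hσ hp).imp_right fun h n _ hmono => h n hmono.tendsto_atTop
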